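/- Let $A,B,C,D\in\mathbb{C}$ be arbitrary and let $$S(\mathbb{C})=\{(x,y,z)\in\mathbb{C}^3 : x^2+y^2+z^2+xyz=Ax+By+Cz+D\},$$ with the topology and Borel $\sigma$-algebra induced from $\mathbb{C}^3$. Let $s_x,s_y,s_z$ be the involutions of $S(\mathbb{C})$ given by $$s_x(x,y,z)=(-x-yz+A,\,y,\,z),\quad s_y(x,y,z)=(x,\,-y-zx+B,\,z),\quad s_z(x,y,z)=(x,\,y,\,-z-xy+C).$$ Let $\mu$ be a probability measure on $\{s_x,s_y,s_z\}$ with $\mu(s_x)\mu(s_y)\mu(s_z)>0$. Let $\nu$ be a Borel probability measure on $S(\mathbb{C})$ that is $\mu$-stationary, that is, $$\nu=\mu(s_x)\,(s_x)_*\nu+\mu(s_y)\,(s_y)_*\nu+\mu(s_z)\,(s_z)_*\nu.$$ Then the support of $\nu$ is compact. -/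

import Mathlib

namespace MarkovFamily

/-- The set `S(ℂ)` of complex points of the affine cubic surface
`x² + y² + z² + xyz = Ax + By + Cz + D` in `ℂ³`. -/
def Surface (A B C D : ℂ) : Set (ℂ × ℂ × ℂ) :=
  {p | p.1 ^ 2 + p.2.1 ^ 2 + p.2.2 ^ 2 + p.1 * p.2.1 * p.2.2
    = A * p.1 + B * p.2.1 + C * p.2.2 + D}

/-- The three letters indexing the Vieta involutions `s_x, s_y, s_z`. -/
inductive Letter
  | x
  | y
  | z

/-- The involution `s_x(x, y, z) = (-x - yz + A, y, z)` of `S(ℂ)`. -/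
def vietaX (A B C D : ℂ) : Surface A B C D ≃ₜ Surface A B C D where
  toFun p := ⟨(-p.1.1 - p.1.2.1 * p.1.2.2 + A, p.1.2.1, p.1.2.2), by
    have h := p.2
    simp only [Surface, Set.mem_ofPred_eq] at h ⊢
    linear_combination h⟩
  invFun p := ⟨(-p.1.1 - p.1.2.1 * p.1.2.2 + A, p.1.2.1, p.1.2.2), by
    have h := p.2
    simp only [Surface, Set.mem_ofPred_eq] at h ⊢
    linear_combination h⟩
  left_inv p := by
    apply Subtype.ext
    simp only [Prod.ext_iff, and_true]
    ring
  right_inv p := by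
    apply Subtype.ext
    simp only [Prod.ext_iff, and_true]
    ring
  continuous_toFun := by fun_prop
  continuous_invFun := by fun_prop

/-- The involution `s_y(x, y, z) = (x, -y - zx + B, z)` of `S(ℂ)`. -/
def vietaY (A B C D : ℂ) : Surface A B C D ≃ₜ Surface A B C D where
  toFun p := ⟨(p.1.1, -p.1.2.1 - p.1.2.2 * p.1.1 + B, p.1.2.2), by
    have h := p.2
    simp only [Surface, Set.mem_ofPred_eq] at h ⊢
    linear_combination h⟩
  invFun p := ⟨(p.1.1, -p.1.2.1 - p.1.2.2 * p.1.1 + B, p.1.2.2), by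
    have h := p.2
    simp only [Surface, Set.mem_ofPred_eq] at h ⊢
    linear_combination h⟩
  left_inv p := by
    apply Subtype.ext
    simp only [Prod.ext_iff, true_and, and_true]
    ring
  right_inv p := by
    apply Subtype.ext
    simp only [Prod.ext_iff, true_and, and_true]
    ring
  continuous_toFun := by fun_prop
  continuous_invFun := by fun_prop

/-- The involution `s_z(x, y, z) = (x, y, -z - xy + C)` of `S(ℂ)`. -/
def vietaZ (A B C D : ℂ) : Surface A B C D ≃ₜ Surface A B C D where
  toFun p := ⟨(p.1.1, p.1.2.1, -p.1.2.2 - p.1.1 * p.1.2.1 + C), by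
    have h := p.2
    simp only [Surface, Set.mem_ofPred_eq] at h ⊢
    linear_combination h⟩
  invFun p := ⟨(p.1.1, p.1.2.1, -p.1.2.2 - p.1.1 * p.1.2.1 + C), by
    have h := p.2
    simp only [Surface, Set.mem_ofPred_eq] at h ⊢
    linear_combination h⟩
  left_inv p := by
    apply Subtype.ext
    simp only [Prod.ext_iff, true_and]
    ring
  right_inv p := by
    apply Subtype.ext
    simp only [Prod.ext_iff, true_and]
    ring
  continuous_toFun := by fun_prop
  continuous_invFun := by fun_prop

/-- The measure `ν` on `S(ℂ)` is `μ`-stationary: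
`μ(s_x) (s_x)_* ν + μ(s_y) (s_y)_* ν + μ(s_z) (s_z)_* ν = ν`. -/
def IsStationary {A B C D : ℂ} (μ : PMF Letter)
    (ν : MeasureTheory.Measure (Surface A B C D)) : Prop :=
  μ Letter.x • ν.map (vietaX A B C D) + μ Letter.y • ν.map (vietaY A B C D)
    + μ Letter.z • ν.map (vietaZ A B C D) = ν

end MarkovFamily

/-! Far out on the surface, the regions where one coordinate dominates two others that are
themselves large are disjoint. Off its own region each involution enters its own region from any
other one, and on its own region it brings points back towards the centre: a ping-pong table for
three involutions. Let $F$ be the product of factors $\rho_s<1$ along the descent of a point out of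
the regions, and $1$ outside them. For suitable $\rho$, $F$ is superharmonic, strictly so on the
regions. Integrating against a stationary probability measure forces equality almost everywhere, so
the regions are null (`measure_eq_zero_of_pingPong`). Every point of large norm enters a region
under some involution (`exists_vieta_mem_dominated`), so by stationarity the complement of a ball is
null too. -/

open MeasureTheory
open scoped ENNReal

namespace MarkovFamily

/-! ### Stationary measures for involutions playing ping-pong -/

section PingPong

variable {ι X : Type*} [Fintype ι]

open Classical in
/-- The `n`-th iterate of the recursion `F p = ρ s * F (σ s p)` for `p ∈ E s`, and `F p = 1` outside
`⋃ s, E s`. -/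
noncomputable def weightAux (σ : ι → X → X) (E : ι → Set X) (ρ : ι → ℝ≥0∞) : ℕ → X → ℝ≥0∞
  | 0, _ => 1
  | n + 1, p => ∏ s, if p ∈ E s then ρ s * weightAux σ E ρ n (σ s p) else 1

/-- The function equal to `1` outside `⋃ s, E s` with `weight p = ρ s * weight (σ s p)` on `E s`. -/
noncomputable def weight (σ : ι → X → X) (E : ι → Set X) (ρ : ι → ℝ≥0∞) (p : X) : ℝ≥0∞ :=
  ⨅ n, weightAux σ E ρ n p

variable {σ : ι → X → X} {E : ι → Set X} {ρ : ι → ℝ≥0∞}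

lemma weightAux_succ_of_mem (hE : ∀ s t p, p ∈ E s → p ∈ E t → s = t) {s : ι} {p : X}
    (hp : p ∈ E s) (n : ℕ) :
    weightAux σ E ρ (n + 1) p = ρ s * weightAux σ E ρ n (σ s p) := by
  rw [weightAux, Finset.prod_eq_single s]
  · simp [hp]
  · intro t _ hts
    rw [if_neg fun ht => hts (hE t s p ht hp)]
  · simp

lemma weightAux_of_notMem {p : X} (hp : ∀ s, p ∉ E s) (n : ℕ) : weightAux σ E ρ n p = 1 := by
  cases n <;> simp [weightAux, hp]

lemma measurable_weightAux [MeasurableSpace X] (hσ : ∀ s, Measurable (σ s))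
    (hE : ∀ s, MeasurableSet (E s)) (n : ℕ) : Measurable (weightAux σ E ρ n) := by
  induction n with
  | zero => exact measurable_const
  | succ n ih =>
    refine Finset.measurable_fun_prod _ fun s _ => ?_
    exact Measurable.ite (hE s) ((ih.comp (hσ s)).const_mul _) measurable_const

lemma measurable_weight [MeasurableSpace X] (hσ : ∀ s, Measurable (σ s))
    (hE : ∀ s, MeasurableSet (E s)) : Measurable (weight σ E ρ) :=
  Measurable.iInf fun n => measurable_weightAux hσ hE n

lemma weight_le_one (p : X) : weight σ E ρ p ≤ 1 := iInf_le _ 0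

lemma weight_of_notMem {p : X} (hp : ∀ s, p ∉ E s) : weight σ E ρ p = 1 := by
  simp [weight, weightAux_of_notMem hp]

/-- Shifting the index in the infimum loses only the initial value `1`, which is harmless because `ρ
s ≤ 1`. -/
lemma weight_of_mem (hρ : ∀ s, ρ s ≤ 1) (hE : ∀ s t p, p ∈ E s → p ∈ E t → s = t) {s : ι} {p : X}
    (hp : p ∈ E s) : weight σ E ρ p = ρ s * weight σ E ρ (σ s p) := by
  have hs : ρ s ≠ ∞ := ((hρ s).trans_lt ENNReal.one_lt_top).ne
  rw [weight, weight, ENNReal.mul_iInf fun h => absurd h hs]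
  refine le_antisymm (le_iInf fun n => ?_) (le_iInf fun n => ?_)
  · rw [← weightAux_succ_of_mem hE hp]
    exact iInf_le _ (n + 1)
  · cases n with
    | zero =>
      refine (iInf_le _ 0).trans ?_
      simpa [weightAux] using hρ s
    | succ n =>
      rw [weightAux_succ_of_mem hE hp]
      exact iInf_le _ n

/-- The height makes every descent finite, so the weight is a finite product of nonzero factors. -/
lemma weight_ne_zero (hρ : ∀ s, ρ s ≤ 1) (hρ0 : ∀ s, ρ s ≠ 0)
    (hE : ∀ s t p, p ∈ E s → p ∈ E t → s = t) (h : X → ℕ)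
    (hh : ∀ s, ∀ p ∈ E s, h (σ s p) < h p) (p : X) : weight σ E ρ p ≠ 0 := by
  induction hn : h p using Nat.strong_induction_on generalizing p with
  | _ n ih =>
    by_cases hp : ∃ s, p ∈ E s
    · obtain ⟨s, hs⟩ := hp
      rw [weight_of_mem hρ hE hs]
      exact mul_ne_zero (hρ0 s) (ih _ (hn ▸ hh s p hs) _ rfl)
    · rw [weight_of_notMem (not_exists.mp hp)]
      exact one_ne_zero

/-- For `t ≠ s`, the descent from `σ t p` passes back through `p`, so its weight is `ρ t * ρ s *
weight (σ s p)`. The claim thus reduces to the scalar inequality `hμρ`. -/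
lemma sum_mul_weight_lt [DecidableEq ι] (hρ : ∀ s, ρ s ≤ 1) (hρ0 : ∀ s, ρ s ≠ 0)
    (hE : ∀ s t p, p ∈ E s → p ∈ E t → s = t) (h : X → ℕ)
    (hh : ∀ s, ∀ p ∈ E s, h (σ s p) < h p) (hinv : ∀ s, Function.Involutive (σ s))
    (hping : ∀ s t, t ≠ s → ∀ p ∈ E s, σ t p ∈ E t) {μ : ι → ℝ≥0∞}
    (hμρ : ∀ s, μ s + (∑ t ∈ Finset.univ.erase s, μ t * ρ t) * ρ s < ρ s) {s : ι} {p : X}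
    (hp : p ∈ E s) :
    ∑ t, μ t * weight σ E ρ (σ t p) < weight σ E ρ p := by
  have hne := weight_ne_zero hρ hρ0 hE h hh (σ s p)
  have htop : weight σ E ρ (σ s p) ≠ ∞ := ((weight_le_one _).trans_lt ENNReal.one_lt_top).ne
  have key : ∑ t, μ t * weight σ E ρ (σ t p)
      = (μ s + (∑ t ∈ Finset.univ.erase s, μ t * ρ t) * ρ s) * weight σ E ρ (σ s p) := by
    rw [← Finset.add_sum_erase _ _ (Finset.mem_univ s), add_mul, Finset.sum_mul, Finset.sum_mul]
    congr 1
    refine Finset.sum_congr rfl fun t ht => ?_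
    rw [weight_of_mem hρ hE (hping s t (Finset.ne_of_mem_erase ht) p hp), hinv t p,
      weight_of_mem hρ hE hp]
    ring
  rw [key, weight_of_mem hρ hE hp]
  exact ENNReal.mul_lt_mul_left hne htop (hμρ s)

/-- Weights `ρ < 1` for which the associated function is strictly superharmonic. -/
lemma exists_superharmonic_weights [DecidableEq ι] (hcard : 3 ≤ Fintype.card ι) {μ : ι → ℝ≥0∞}
    (hμ0 : ∀ s, μ s ≠ 0) (hμ1 : ∑ s, μ s = 1) :
    ∃ ρ : ι → ℝ≥0∞, (∀ s, ρ s ≤ 1) ∧ (∀ s, ρ s ≠ 0) ∧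
      ∀ s, μ s + (∑ t ∈ Finset.univ.erase s, μ t * ρ t) * ρ s < ρ s := by
  have hμle (s) : μ s ≤ 1 := hμ1 ▸ Finset.single_le_sum (fun _ _ => zero_le) (Finset.mem_univ s)
  have hμtop (s) : μ s ≠ ∞ := ((hμle s).trans_lt ENNReal.one_lt_top).ne
  obtain ⟨m, hm⟩ : ∃ m : ι → ℝ, ∀ s, m s = (μ s).toReal := ⟨_, fun _ => rfl⟩
  have hm0 (s) : 0 < m s := hm s ▸ ENNReal.toReal_pos (hμ0 s) (hμtop s)
  have hm1 : ∑ s, m s = 1 := by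
    simp_rw [hm]
    rw [← ENNReal.toReal_sum fun s _ => hμtop s, hμ1, ENNReal.toReal_one]
  have hofm (s) : μ s = ENNReal.ofReal (m s) := by rw [hm, ENNReal.ofReal_toReal (hμtop s)]
  have hcard' : (3 : ℝ) ≤ Fintype.card ι := by exact_mod_cast hcard
  have : Nonempty ι := Fintype.card_pos_iff.mp (by omega)
  obtain ⟨s₀, hs₀⟩ := Finite.exists_min m
  obtain ⟨N, hN⟩ : ∃ N : ℝ, N = Fintype.card ι := ⟨_, rfl⟩
  rw [← hN] at hcard'
  -- With `ρ s = 1 - ε / m s`, every product `m s * ρ s` is simply `m s - ε`.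
  obtain ⟨ε, hε0, hε⟩ : ∃ ε, 0 < ε ∧ ε * N = m s₀ :=
    ⟨m s₀ / N, div_pos (hm0 _) (by linarith), div_mul_cancel₀ _ (by linarith)⟩
  have hεm (s) : ε * N ≤ m s := hε ▸ hs₀ s
  have hr (s) : 0 < 1 - ε / m s := by
    rw [sub_pos, div_lt_one (hm0 s)]
    nlinarith [hεm s]
  refine ⟨fun s => ENNReal.ofReal (1 - ε / m s), fun s => ?_, fun s => ?_, fun s => ?_⟩
  · rw [← ENNReal.ofReal_one]
    exact ENNReal.ofReal_le_ofReal (by linarith [div_pos hε0 (hm0 s)])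
  · simpa using hr s
  · have hsum : ∑ t ∈ Finset.univ.erase s, μ t * ENNReal.ofReal (1 - ε / m t)
        = ENNReal.ofReal (1 - m s - (N - 1) * ε) := by
      have e1 : ∀ t, m t * (1 - ε / m t) = m t - ε := fun t => by
        have := (hm0 t).ne'
        field_simp
      simp_rw [hofm, ← ENNReal.ofReal_mul (hm0 _).le, e1]
      rw [← ENNReal.ofReal_sum_of_nonneg fun t _ => ?_]
      · rw [Finset.sum_erase_eq_sub (Finset.mem_univ s), Finset.sum_sub_distrib, hm1]
        simp only [Finset.sum_const, Finset.card_univ, nsmul_eq_mul]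
        rw [← hN]
        congr 1
        ring
      · nlinarith [hεm t]
    have hnonneg : 0 ≤ 1 - m s - (N - 1) * ε := by
      have h1 : ∑ t ∈ Finset.univ.erase s, (m t - ε) = 1 - m s - (N - 1) * ε := by
        rw [Finset.sum_erase_eq_sub (Finset.mem_univ s), Finset.sum_sub_distrib, hm1]
        simp only [Finset.sum_const, Finset.card_univ, nsmul_eq_mul]
        rw [← hN]
        ring
      rw [← h1]
      exact Finset.sum_nonneg fun t _ => by nlinarith [hεm t]
    rw [hsum, hofm, ← ENNReal.ofReal_mul hnonneg,
      ← ENNReal.ofReal_add (hm0 s).le (mul_nonneg hnonneg (hr s).le),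
      ENNReal.ofReal_lt_ofReal_iff (hr s)]
    obtain ⟨q, hq⟩ : ∃ q, q = ε / m s := ⟨_, rfl⟩
    have hqm : q * m s = ε := by rw [hq, div_mul_cancel₀ _ (hm0 s).ne']
    have hqN : q * N ≤ 1 := by
      rw [hq, div_mul_eq_mul_div, div_le_one (hm0 s)]
      exact hεm s
    rw [← hq]
    have hq0 : 0 < q := hq ▸ div_pos hε0 (hm0 s)
    -- Since `q ≤ 1 / N`, one has `(N - 1) * (1 - q) ≥ (N - 1) ^ 2 / N`, which exceeds `1` because
    -- `N ≥ 3`.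
    have h2 : 0 < ε * ((N - 1) * (1 - q) - 1) :=
      mul_pos hε0 (by nlinarith)
    nlinarith

variable [MeasurableSpace X]

/-- A stationary probability measure for at least three involutions playing ping-pong on disjoint
sets `E s`, each of them decreasing a height on its own set, gives no mass to these sets. -/
theorem measure_eq_zero_of_pingPong (hcard : 3 ≤ Fintype.card ι) (hσ : ∀ s, Measurable (σ s))
    (hEm : ∀ s, MeasurableSet (E s)) (hE : ∀ s t p, p ∈ E s → p ∈ E t → s = t) (h : X → ℕ)
    (hh : ∀ s, ∀ p ∈ E s, h (σ s p) < h p) (hinv : ∀ s, Function.Involutive (σ s))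
    (hping : ∀ s t, t ≠ s → ∀ p ∈ E s, σ t p ∈ E t) {μ : ι → ℝ≥0∞}
    (hμ0 : ∀ s, μ s ≠ 0) (hμ1 : ∑ s, μ s = 1) {ν : Measure X} [IsProbabilityMeasure ν]
    (hν : ∑ s, μ s • ν.map (σ s) = ν) (s : ι) : ν (E s) = 0 := by
  classical
  obtain ⟨ρ, hρ, hρ0, hμρ⟩ := exists_superharmonic_weights hcard hμ0 hμ1
  have hF : Measurable (weight σ E ρ) := measurable_weight hσ hEm
  have hlt : ∀ s, ∀ p ∈ E s, ∑ t, μ t * weight σ E ρ (σ t p) < weight σ E ρ p :=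
    fun s p hp => sum_mul_weight_lt hρ hρ0 hE h hh hinv hping hμρ hp
  have hle : ∀ p, ∑ t, μ t * weight σ E ρ (σ t p) ≤ weight σ E ρ p := by
    intro p
    by_cases hp : ∃ s, p ∈ E s
    · obtain ⟨s, hs⟩ := hp
      exact (hlt s p hs).le
    · rw [weight_of_notMem (not_exists.mp hp), ← hμ1]
      exact Finset.sum_le_sum fun t _ => mul_le_of_le_one_right' (weight_le_one _)
  have hint : ∫⁻ p, ∑ t, μ t * weight σ E ρ (σ t p) ∂ν = ∫⁻ p, weight σ E ρ p ∂ν := by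
    conv_rhs => rw [← hν]
    have hFσ (t) : Measurable fun p => weight σ E ρ (σ t p) := hF.comp (hσ t)
    rw [lintegral_finsetSum_measure, lintegral_finsetSum _ fun t _ => (hFσ t).const_mul _]
    refine Finset.sum_congr rfl fun t _ => ?_
    rw [lintegral_smul_measure, lintegral_map hF (hσ t), lintegral_const_mul _ (hFσ t),
      smul_eq_mul]
  have hfin : ∫⁻ p, ∑ t, μ t * weight σ E ρ (σ t p) ∂ν ≠ ∞ := by
    rw [hint]
    refine ((lintegral_mono fun p => weight_le_one p).trans_lt ?_).ne
    simp
  -- A pointwise inequality between functions of equal finite integral is an equality almost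
  -- everywhere, so the set of strict inequality is null.
  have hae := ae_eq_of_ae_le_of_lintegral_le (Filter.Eventually.of_forall hle) hfin hF.aemeasurable
    hint.ge
  refine measure_mono_null (fun p hp => ?_) (ae_iff.mp hae)
  exact (hlt s p hp).ne

end PingPong

/-! ### Coordinates and Vieta involutions on the surface -/

section Surface

variable {A B C D : ℂ}

instance : Fintype Letter where
  elems := ⟨([.x, .y, .z] : List Letter), by simp⟩
  complete s := by cases s <;> simp

/-- The coordinates on the surface, indexed by the letters. -/
def coord : Letter → Surface A B C D → ℂ
  | .x, p => p.1.1
  | .y, p => p.1.2.1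
  | .z, p => p.1.2.2

/-- The Vieta involutions, indexed by the letters. -/
def vieta : Letter → Surface A B C D ≃ₜ Surface A B C D
  | .x => vietaX A B C D
  | .y => vietaY A B C D
  | .z => vietaZ A B C D

/-- The linear coefficients of the equation, indexed by the letters. -/
def coeff (A B C : ℂ) : Letter → ℂ
  | .x => A
  | .y => B
  | .z => C

/-- The points for which the coordinate `s` dominates the two others, which are at least `R`. -/
def dominated (R : ℝ) (s : Letter) : Set (Surface A B C D) :=
  {p | ∀ t, t ≠ s → R ≤ ‖coord t p‖ ∧ 2 * ‖coord t p‖ ≤ ‖coord s p‖}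

lemma continuous_coord (s : Letter) : Continuous (coord s : Surface A B C D → ℂ) := by
  cases s <;> unfold coord <;> fun_prop

lemma vieta_involutive (s : Letter) :
    Function.Involutive (vieta s : Surface A B C D → Surface A B C D) := by
  cases s
  exacts [(vietaX A B C D).left_inv, (vietaY A B C D).left_inv, (vietaZ A B C D).left_inv]

lemma coord_vieta_of_ne {s t : Letter} (h : t ≠ s) (p : Surface A B C D) :
    coord t (vieta s p) = coord t p := by
  cases s <;> cases t <;> first | rfl | exact absurd rfl h

lemma coord_vieta_self {s t u : Letter} (hst : s ≠ t) (hsu : s ≠ u) (htu : t ≠ u)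
    (p : Surface A B C D) :
    coord s (vieta s p) = -coord s p - coord t p * coord u p + coeff A B C s := by
  cases s <;> cases t <;> cases u <;> first
    | rfl
    | exact absurd rfl hst
    | exact absurd rfl hsu
    | exact absurd rfl htu
    | (simp only [coord, vieta, vietaX, vietaY, vietaZ, coeff, Homeomorph.homeomorph_mk_coe,
        Equiv.coe_fn_mk]; ring)

lemma coord_equation {s t u : Letter} (hst : s ≠ t) (hsu : s ≠ u) (htu : t ≠ u)
    (p : Surface A B C D) :
    coord s p ^ 2 + coord t p ^ 2 + coord u p ^ 2 + coord s p * coord t p * coord u p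
      = coeff A B C s * coord s p + coeff A B C t * coord t p + coeff A B C u * coord u p + D := by
  have h : _ = _ := p.2
  cases s <;> cases t <;> cases u <;> first
    | exact absurd rfl hst
    | exact absurd rfl hsu
    | exact absurd rfl htu
    | (simp only [coord, coeff]; linear_combination h)

/-- The involution exchanges the roots of the equation seen as a quadratic in one coordinate; this
is their product. -/
lemma coord_mul_coord_vieta {s t u : Letter} (hst : s ≠ t) (hsu : s ≠ u) (htu : t ≠ u)
    (p : Surface A B C D) :
    coord s p * coord s (vieta s p)
      = coord t p ^ 2 + coord u p ^ 2 - coeff A B C t * coord t p - coeff A B C u * coord u p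
        - D := by
  rw [coord_vieta_self hst hsu htu]
  linear_combination -(coord_equation hst hsu htu p)

lemma exists_others (s : Letter) : ∃ t u : Letter, s ≠ t ∧ s ≠ u ∧ t ≠ u := by
  cases s
  exacts [⟨.y, .z, by simp⟩, ⟨.x, .z, by simp⟩, ⟨.x, .y, by simp⟩]

lemma eq_or_eq_of_ne {s t u v : Letter} (hst : s ≠ t) (hsu : s ≠ u) (htu : t ≠ u) (hv : v ≠ s) :
    v = t ∨ v = u := by
  cases s <;> cases t <;> cases u <;> cases v <;> simp_all

lemma sum_letter {M : Type*} [AddCommMonoid M] (f : Letter → M) :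
    ∑ s, f s = f .x + f .y + f .z := by
  have h : ∑ s, f s = f .x + (f .y + (f .z + 0)) := rfl
  rw [h, add_zero, add_assoc]

lemma sum_letter_of_ne {s t u : Letter} (hst : s ≠ t) (hsu : s ≠ u) (htu : t ≠ u) (f : Letter → ℝ) :
    ∑ v, f v = f s + f t + f u := by
  rw [sum_letter]
  cases s <;> cases t <;> cases u <;> first
    | exact absurd rfl hst
    | exact absurd rfl hsu
    | exact absurd rfl htu
    | ring

lemma exists_sorted (f : Letter → ℝ) :
    ∃ s t u : Letter, s ≠ t ∧ s ≠ u ∧ t ≠ u ∧ f u ≤ f t ∧ f t ≤ f s := by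
  rcases le_total (f .x) (f .y) with h1 | h1 <;> rcases le_total (f .y) (f .z) with h2 | h2 <;>
    rcases le_total (f .x) (f .z) with h3 | h3
  exacts [⟨.z, .y, .x, by simp [*]⟩, ⟨.z, .y, .x, by simp [*]⟩, ⟨.y, .z, .x, by simp [*]⟩,
    ⟨.y, .x, .z, by simp [*]⟩, ⟨.z, .x, .y, by simp [*]⟩, ⟨.x, .z, .y, by simp [*]⟩,
    ⟨.x, .y, .z, by simp [*]⟩, ⟨.x, .y, .z, by simp [*]⟩]

lemma measurableSet_dominated (R : ℝ) (s : Letter) :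
    MeasurableSet (dominated R s : Set (Surface A B C D)) := by
  refine IsClosed.measurableSet ?_
  simp only [dominated, Set.ofPred_forall, Set.ofPred_and]
  refine isClosed_iInter fun t => isClosed_iInter fun _ => IsClosed.inter ?_ ?_
  · exact isClosed_le continuous_const (continuous_coord t).norm
  · exact isClosed_le ((continuous_coord t).norm.const_mul 2) (continuous_coord s).norm

lemma eq_of_mem_dominated {R : ℝ} (hR : 0 < R) {s t : Letter} {p : Surface A B C D}
    (hs : p ∈ dominated R s) (ht : p ∈ dominated R t) : s = t := by
  by_contra h
  have h1 := hs t (Ne.symm h)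
  have h2 := ht s h
  linarith

/-! ### Norm estimates near infinity -/

/-- A common bound for the coefficients of the equation. -/
noncomputable def bound (A B C D : ℂ) : ℝ := ‖A‖ + ‖B‖ + ‖C‖ + ‖D‖

lemma norm_coeff_le_bound (s : Letter) : ‖coeff A B C s‖ ≤ bound A B C D := by
  have := norm_nonneg A; have := norm_nonneg B; have := norm_nonneg C; have := norm_nonneg D
  cases s <;> simp only [coeff, bound] <;> linarith

lemma norm_const_le_bound : ‖D‖ ≤ bound A B C D := by
  have := norm_nonneg A; have := norm_nonneg B; have := norm_nonneg C
  simp only [bound]; linarith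

lemma le_norm_coord_vieta {s t u : Letter} (hst : s ≠ t) (hsu : s ≠ u) (htu : t ≠ u)
    (p : Surface A B C D) :
    ‖coord t p‖ * ‖coord u p‖ - ‖coord s p‖ - bound A B C D ≤ ‖coord s (vieta s p)‖ := by
  have h1 := norm_coeff_le_bound (A := A) (B := B) (C := C) (D := D) s
  have h2 : coord t p * coord u p
      = coeff A B C s - coord s p - coord s (vieta s p) := by
    rw [coord_vieta_self hst hsu htu]; ring
  have h3 := norm_mul (coord t p) (coord u p)
  rw [h2] at h3
  have h4 := norm_sub_le (coeff A B C s - coord s p) (coord s (vieta s p))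
  have h5 := norm_sub_le (coeff A B C s) (coord s p)
  linarith

lemma vieta_mem_dominated_of_le {R : ℝ} (hR : bound A B C D + 5 ≤ R) {s t u : Letter}
    (hst : s ≠ t) (hsu : s ≠ u) (htu : t ≠ u) {p : Surface A B C D} (ht : R ≤ ‖coord t p‖)
    (htu' : ‖coord t p‖ ≤ ‖coord u p‖) (hsu' : ‖coord s p‖ ≤ ‖coord u p‖) :
    vieta s p ∈ dominated R s := by
  have h := le_norm_coord_vieta hst hsu htu p
  have hK := (norm_nonneg _).trans (norm_const_le_bound (A := A) (B := B) (C := C) (D := D))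
  have h2 : R * ‖coord u p‖ ≤ ‖coord t p‖ * ‖coord u p‖ :=
    mul_le_mul_of_nonneg_right ht (norm_nonneg _)
  -- The new coordinate is at least `(R - 1) * ‖coord u p‖ - K` with `K` the bound of the
  -- coefficients, and `R ≥ K + 5`.
  have h3 : 2 * ‖coord u p‖ ≤ ‖coord s (vieta s p)‖ := by nlinarith
  intro v hv
  rw [coord_vieta_of_ne hv]
  rcases eq_or_eq_of_ne hst hsu htu hv with rfl | rfl
  · exact ⟨ht, by linarith⟩
  · exact ⟨by linarith, h3⟩

lemma vieta_mem_dominated_of_mem {R : ℝ} (hR : bound A B C D + 5 ≤ R) {s t : Letter}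
    (hts : t ≠ s) {p : Surface A B C D} (hp : p ∈ dominated R s) : vieta t p ∈ dominated R t := by
  have hK := (norm_nonneg _).trans (norm_const_le_bound (A := A) (B := B) (C := C) (D := D))
  obtain ⟨v, hvs, hvt⟩ : ∃ v, v ≠ s ∧ v ≠ t := by
    obtain ⟨v, w, hsv, hsw, hvw⟩ := exists_others s
    by_cases hvt : v = t
    · exact ⟨w, hsw.symm, hvt ▸ hvw.symm⟩
    · exact ⟨v, hsv.symm, hvt⟩
  have h1 := hp t hts
  have h2 := hp v hvs
  exact vieta_mem_dominated_of_le hR hvt.symm hts hvs h2.1 (by linarith) (by linarith)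

/-- The product of the two roots is at most `(1/4 + 1/4 + 1/10) * a ^ 2`, with `a` the dominant
norm, so the other root has norm at most `3 / 5 * a`; and `a ≥ 20`. -/
lemma norm_coord_vieta_add_one_le {R : ℝ} (hR : 10 * bound A B C D + 10 ≤ R) {s : Letter}
    {p : Surface A B C D} (hp : p ∈ dominated R s) :
    ‖coord s (vieta s p)‖ + 1 ≤ ‖coord s p‖ := by
  obtain ⟨t, u, hst, hsu, htu⟩ := exists_others s
  have hK := (norm_nonneg _).trans (norm_const_le_bound (A := A) (B := B) (C := C) (D := D))
  have h1 := hp t hst.symm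
  have h2 := hp u hsu.symm
  have h := congrArg norm (coord_mul_coord_vieta hst hsu htu p)
  have hct := mul_le_mul_of_nonneg_right
    (norm_coeff_le_bound (A := A) (B := B) (C := C) (D := D) t) (norm_nonneg (coord t p))
  have hcu := mul_le_mul_of_nonneg_right
    (norm_coeff_le_bound (A := A) (B := B) (C := C) (D := D) u) (norm_nonneg (coord u p))
  have hD := norm_const_le_bound (A := A) (B := B) (C := C) (D := D)
  have e1 := norm_sub_le (coord t p ^ 2 + coord u p ^ 2 - coeff A B C t * coord t p
    - coeff A B C u * coord u p) D
  have e2 := norm_sub_le (coord t p ^ 2 + coord u p ^ 2 - coeff A B C t * coord t p)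
    (coeff A B C u * coord u p)
  have e3 := norm_sub_le (coord t p ^ 2 + coord u p ^ 2) (coeff A B C t * coord t p)
  have e4 := norm_add_le (coord t p ^ 2) (coord u p ^ 2)
  rw [norm_mul] at h e2 e3
  rw [norm_pow, norm_pow] at e4
  generalize ‖coord s (vieta s p)‖ = w at *
  generalize ‖coord s p‖ = a at *
  generalize ‖coord t p‖ = b at *
  generalize ‖coord u p‖ = c at *
  generalize bound A B C D = K at *
  have f1 : a * w ≤ b ^ 2 + c ^ 2 + K * (b + c + 1) := by linarith
  have f2 : b ^ 2 ≤ a * a / 4 := by nlinarith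
  have f3 : c ^ 2 ≤ a * a / 4 := by nlinarith
  have f4 : K * (b + c + 1) ≤ a / 20 * (2 * a) :=
    mul_le_mul (by linarith) (by linarith) (by linarith) (by linarith)
  have f5 : a * w ≤ a * (3 / 5 * a) := by nlinarith
  have f6 := le_of_mul_le_mul_left f5 (by linarith)
  linarith

lemma exists_vieta_mem_dominated {R : ℝ} (hR : bound A B C D + 5 ≤ R) {p : Surface A B C D}
    {v : Letter} (hv : 7 * R ^ 2 < ‖coord v p‖) : ∃ s, vieta s p ∈ dominated R s := by
  obtain ⟨s, t, u, hst, hsu, htu, hut', hts'⟩ := exists_sorted fun s => ‖coord s p‖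
  have hvs : ‖coord v p‖ ≤ ‖coord s p‖ := by
    by_cases hvs : v = s
    · rw [hvs]
    · rcases eq_or_eq_of_ne hst hsu htu hvs with rfl | rfl <;> linarith
  -- The smallest coordinate is the one to change; it remains to see that the middle one is at least
  -- `R`.
  refine ⟨u, vieta_mem_dominated_of_le hR htu.symm hsu.symm hst.symm ?_ hts' (hut'.trans hts')⟩
  by_contra! hlt
  have hK := (norm_nonneg _).trans (norm_const_le_bound (A := A) (B := B) (C := C) (D := D))
  have h : coord s p ^ 2 = coeff A B C s * coord s p + coeff A B C t * coord t p
      + coeff A B C u * coord u p + D - coord t p ^ 2 - coord u p ^ 2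
      - coord s p * coord t p * coord u p := by
    linear_combination coord_equation hst hsu htu p
  have h' := congrArg norm h
  have e1 := norm_sub_le (coeff A B C s * coord s p + coeff A B C t * coord t p
      + coeff A B C u * coord u p + D - coord t p ^ 2 - coord u p ^ 2)
      (coord s p * coord t p * coord u p)
  have e2 := norm_sub_le (coeff A B C s * coord s p + coeff A B C t * coord t p
      + coeff A B C u * coord u p + D - coord t p ^ 2) (coord u p ^ 2)
  have e3 := norm_sub_le (coeff A B C s * coord s p + coeff A B C t * coord t p
      + coeff A B C u * coord u p + D) (coord t p ^ 2)
  have e4 := norm_add₄_le (a := coeff A B C s * coord s p) (b := coeff A B C t * coord t p)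
      (c := coeff A B C u * coord u p) (d := D)
  have hcs := mul_le_mul_of_nonneg_right
    (norm_coeff_le_bound (A := A) (B := B) (C := C) (D := D) s) (norm_nonneg (coord s p))
  have hct := mul_le_mul_of_nonneg_right
    (norm_coeff_le_bound (A := A) (B := B) (C := C) (D := D) t) (norm_nonneg (coord t p))
  have hcu := mul_le_mul_of_nonneg_right
    (norm_coeff_le_bound (A := A) (B := B) (C := C) (D := D) u) (norm_nonneg (coord u p))
  have hD := norm_const_le_bound (A := A) (B := B) (C := C) (D := D)
  have hb := norm_nonneg (coord t p)
  have hc := norm_nonneg (coord u p)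
  simp only [norm_mul, norm_pow] at h' e1 e2 e3 e4
  generalize ‖coord s p‖ = a at *
  generalize ‖coord t p‖ = b at *
  generalize ‖coord u p‖ = c at *
  generalize bound A B C D = K at *
  have ha : 7 * R ^ 2 < a := hv.trans_le hvs
  have hR2 : 1 ≤ R ^ 2 := by nlinarith
  have g1 : b ^ 2 ≤ R ^ 2 := by nlinarith
  have g2 : c ^ 2 ≤ R ^ 2 := by nlinarith
  have g3 : b * c ≤ R ^ 2 := by nlinarith
  have g4 : a * b * c ≤ a * R ^ 2 := by
    rw [mul_assoc]
    exact mul_le_mul_of_nonneg_left g3 (by linarith)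
  have g5 : K * b ≤ R ^ 2 := by nlinarith
  have g6 : K * c ≤ R ^ 2 := by nlinarith
  have g7 : K ≤ R ^ 2 := by nlinarith
  have g8 : K * a ≤ R ^ 2 * a := mul_le_mul_of_nonneg_right g7 (by linarith)
  -- The estimates add up to `a ^ 2 ≤ 2 * R ^ 2 * a + 5 * R ^ 2 ≤ 7 * R ^ 2 * a`, whence the
  -- constant `7`.
  nlinarith

end Surface

end MarkovFamily

open MarkovFamily in
theorem mainTheorem2 (A B C D : ℂ) (μ : PMF MarkovFamily.Letter)
    (hμ : 0 < μ MarkovFamily.Letter.x * μ MarkovFamily.Letter.y * μ MarkovFamily.Letter.z)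
    (ν : MeasureTheory.Measure (MarkovFamily.Surface A B C D))
    (hprob : MeasureTheory.IsProbabilityMeasure ν)
    (hν : MarkovFamily.IsStationary μ ν) :
    IsCompact ν.support := by
  have hμ0 : ∀ s, μ s ≠ 0 := by
    rintro (_ | _ | _) h <;> simp [h] at hμ
  have hμ1 : ∑ s, μ s = 1 := by rw [← μ.tsum_coe, tsum_fintype]
  have hν' : ∑ s, μ s • ν.map (vieta s) = ν := (sum_letter _).trans hν
  set R : ℝ := 10 * bound A B C D + 10 with hR
  have hK := (norm_nonneg _).trans (norm_const_le_bound (A := A) (B := B) (C := C) (D := D))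
  have hmeas (s : Letter) : Measurable (vieta s : Surface A B C D → Surface A B C D) :=
    (vieta s).continuous.measurable
  have hnull : ∀ s, ν (dominated R s) = 0 := by
    refine measure_eq_zero_of_pingPong (σ := fun s => vieta s) (by rfl) hmeas
      (measurableSet_dominated R) (fun s t p => eq_of_mem_dominated (by linarith))
      (fun p => ⌊∑ s, ‖coord s p‖⌋₊) (fun s p hp => ?_) vieta_involutive
      (fun s t hts p hp => vieta_mem_dominated_of_mem (by linarith) hts hp) hμ0 hμ1 hν'
    -- Only one coordinate changes and its norm drops by at least `1`, so the floor of the sum drops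
    -- strictly.
    obtain ⟨t, u, hst, hsu, htu⟩ := exists_others s
    have h := norm_coord_vieta_add_one_le hR.ge hp
    rw [sum_letter_of_ne hst hsu htu, sum_letter_of_ne hst hsu htu, coord_vieta_of_ne hst.symm,
      coord_vieta_of_ne hsu.symm, Nat.lt_iff_add_one_le, ← Nat.floor_add_one (by positivity)]
    exact Nat.floor_le_floor (by linarith)
  have hfar : ν {p | ∃ v, 7 * R ^ 2 < ‖coord v p‖} = 0 := by
    refine measure_mono_null (t := ⋃ s, vieta s ⁻¹' dominated R s) ?_
      (measure_iUnion_null fun s => ?_)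
    · rintro p ⟨v, hv⟩
      exact Set.mem_iUnion.mpr (exists_vieta_mem_dominated (by linarith) hv)
    · rw [← Measure.map_apply (hmeas s) (measurableSet_dominated R s)]
      have h := hnull s
      -- Stationarity writes the null mass of the region as a sum of nonnegative terms, one of them
      -- `μ s` times the mass of the preimage.
      rw [← hν', Measure.finsetSum_apply] at h
      have h' := Finset.sum_eq_zero_iff.mp h s (Finset.mem_univ s)
      simpa [hμ0 s] using h'
  have hopen : IsOpen {p : Surface A B C D | ∃ v, 7 * R ^ 2 < ‖coord v p‖} := by
    rw [Set.ofPred_exists]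
    exact isOpen_iUnion fun v => isOpen_lt continuous_const (continuous_coord v).norm
  have hclosed : IsClosed (Surface A B C D) := isClosed_eq (by fun_prop) (by fun_prop)
  have hsub : ν.support ⊆ Subtype.val ⁻¹' Metric.closedBall (0 : ℂ × ℂ × ℂ) (7 * R ^ 2) := by
    intro p hp
    have hp' : p ∉ {p : Surface A B C D | ∃ v, 7 * R ^ 2 < ‖coord v p‖} := fun hmem =>
      Measure.subset_compl_support_of_isOpen hopen hfar hmem hp
    simp only [Set.mem_ofPred_eq, not_exists, not_lt] at hp'
    simp only [Set.mem_preimage, mem_closedBall_zero_iff, Prod.norm_def, max_le_iff]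
    exact ⟨hp' .x, hp' .y, hp' .z⟩
  exact (hclosed.isClosedEmbedding_subtypeVal.isCompact_preimage
    (isCompact_closedBall _ _)).of_isClosed_subset Measure.isClosed_support hsub
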